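/- Let $\mathbb{D}$ be the open unit disc. Let $W:(0,1]\to(0,1]$ be a good weight, that is, a continuous non-decreasing function with $\lim_{t\to0+}W(t)=0$ for which there is a constant $C>1$ such that $\log\frac{1}{W(t/2)}\le C\log\frac{1}{W(t)}$ for all sufficiently small $t>0$. Let $A^\infty(W)$ be the space of holomorphic functions $f$ on $\mathbb{D}$ with $\lim_{|z|\to1-}W(1-|z|)\,|f(z)|=0$, equipped with the norm $\|f\|_{A^\infty(W)}=\sup_{z\in\mathbb{D}}W(1-|z|)\,|f(z)|$. Suppose that \[ \int_0^1\log W(t)\,dt=-\infty . \] Then for every finite positive Borel measure $\mu$ on $\partial\mathbb{D}$ that is singular with respect to Lebesgue (arc length) measure, the singular inner function \[ \Theta_\mu(z)=\exp\left(-\int_{\partial\mathbb{D}}\frac{\zeta+z}{\zeta-z}\,d\mu(\zeta)\right),\qquad z\in\mathbb{D}, \] is cyclic in $A^\infty(W)$; that is, $\Theta_\mu\in A^\infty(W)$ and the linear span of $\{z^n\Theta_\mu(z): n=0,1,2,\dots\}$ is dense in $A^\infty(W)$. -/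

import Mathlib

open Set Filter Topology MeasureTheory
open scoped ENNReal

namespace GrowthSpace

/-- A good weight: a continuous non-decreasing `W : (0,1] → (0,1]` with `W(t) → 0` as `t → 0+`
and `log (1/W(t/2)) ≤ C log (1/W(t))` for some `C > 1` and all sufficiently small `t > 0`.
Only the values of `W` on `(0,1]` matter. -/
structure IsGoodWeight (W : ℝ → ℝ) : Prop where
  mapsTo : MapsTo W (Ioc 0 1) (Ioc 0 1)
  continuousOn : ContinuousOn W (Ioc 0 1)
  monotoneOn : MonotoneOn W (Ioc 0 1)
  tendsto_zero : Tendsto W (𝓝[>] 0) (𝓝 0)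
  log_doubling : ∃ C : ℝ, 1 < C ∧
    ∀ᶠ t in 𝓝[>] (0 : ℝ), Real.log (1 / W (t / 2)) ≤ C * Real.log (1 / W t)

/-- `∫₀¹ log W(t) dt = -∞`; since `0 < W ≤ 1` on `(0,1]`, this says that the nonnegative function
`log (1/W)` has infinite Lebesgue integral over `(0,1]`. -/
def LogIntegralDiverges (W : ℝ → ℝ) : Prop :=
  ∫⁻ t in Ioc (0 : ℝ) 1, ENNReal.ofReal (Real.log (1 / W t)) = ∞

/-- Membership in `A^∞(W)`: `f` is holomorphic in the open unit disc and
`W(1-|z|) |f(z)| → 0` as `|z| → 1-`. Values of `f` outside the disc are irrelevant. -/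
structure MemAInfty (W : ℝ → ℝ) (f : ℂ → ℂ) : Prop where
  holomorphic : DifferentiableOn ℂ f (Metric.ball 0 1)
  tendsto_zero : Tendsto (fun z : ℂ => W (1 - ‖z‖) * ‖f z‖)
    (comap (fun z : ℂ => ‖z‖) (𝓝[<] 1)) (𝓝 0)

/-- The norm `sup_{|z|<1} W(1-|z|) |f(z)|` of `A^∞(W)`, as an extended nonnegative number. -/
noncomputable def normAInfty (W : ℝ → ℝ) (f : ℂ → ℂ) : ℝ≥0∞ :=
  ⨆ z ∈ Metric.ball (0 : ℂ) 1, ENNReal.ofReal (W (1 - ‖z‖) * ‖f z‖)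

/-- `f` is cyclic in `A^∞(W)`: it belongs to `A^∞(W)` and the linear span of the functions
`z ↦ zⁿ f(z)`, `n = 0, 1, 2, …`, is dense in `A^∞(W)` for its norm. -/
def IsCyclicAInfty (W : ℝ → ℝ) (f : ℂ → ℂ) : Prop :=
  MemAInfty W f ∧
    ∀ g : ℂ → ℂ, MemAInfty W g → ∀ ε : ℝ≥0∞, 0 < ε →
      ∃ h ∈ Submodule.span ℂ (range fun (n : ℕ) (z : ℂ) => z ^ n * f z),
        normAInfty W (g - h) < ε

/-- `Θ_μ(z) = exp (-∫ (ζ + z)/(ζ - z) dμ(ζ))` for `μ` a measure on the unit circle; when `μ` is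
finite and singular to arc length this is the singular inner function with measure `μ`. -/
noncomputable def singularInner (μ : Measure (Metric.sphere (0 : ℂ) 1)) (z : ℂ) : ℂ :=
  Complex.exp (-∫ ζ, ((ζ : ℂ) + z) / ((ζ : ℂ) - z) ∂μ)

/-- Arc length (total mass `2π`) on the unit circle. -/
noncomputable def arcLength : Measure (Metric.sphere (0 : ℂ) 1) :=
  (volume : Measure ℂ).toSphere

end GrowthSpace

namespace GrowthSpace

open Complex

/-! ### Singular inner functions -/

/-! Since polynomials are dense in `A^∞(W)` (`exists_polynomial_near`) and each is bounded on the
disc, it is enough to approximate `1` by polynomial multiples of `Θ_μ`.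

Choose scales `δ_j` with `log (1 / W (δ_j)) = 2 ^ j`. Divergence of the logarithmic integral forces
`∑ 2 ^ j δ_j = ∞` (`not_summable_scales`). Hence, starting from any large index `J`, a finite block
of scales suffices to write `μ = ∑ ν_j`, where `ν_j` has mass at most a constant times `ε 2 ^ j δ_j`
on each dyadic arc of length comparable to `δ_j` (`exists_decomposition`). The Poisson integral of
`ν_j` is then at most `x = ε 2 ^ j` on `‖z‖ ≤ 1 - δ_j` (`integral_poissonKernel_le`), so `|Θ_{ν_j}|
≥ exp (-x)` there.

Truncating the Taylor series of `1 / Θ_{ν_j}` at degree about `x / δ_j` gives a polynomial `f_j`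
with `f_j Θ_{ν_j}` within `exp (-8x)` of `1` on `‖z‖ ≤ 1 - 16 δ_j`, and at most `exp (4x)` on the
whole disc (`exists_polynomial_mul_near_one`). In the remaining annulus log-doubling makes `W ≤ exp
(-12x)`, provided `ε` is small. So the weighted error of each factor is at most `exp (-8x)`
(`eventually_exists_polynomial`).

The exponents `ε 2 ^ j` grow geometrically, so all earlier factors together cost no more than `exp
(4x)`. Telescoping `1 - ∏ f_j Θ_{ν_j}` leaves a tail of `∑ exp (-4 ε 2 ^ j)`, which is small once
`J` is large. -/

lemma norm_sub_sphere_ge (ζ : Metric.sphere (0 : ℂ) 1) (z : ℂ) : 1 - ‖z‖ ≤ ‖(ζ : ℂ) - z‖ := by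
  have h1 : ‖(ζ : ℂ)‖ = 1 := by simp
  have := norm_sub_norm_le (ζ : ℂ) z
  linarith

lemma sphere_sub_ne_zero (ζ : Metric.sphere (0 : ℂ) 1) {z : ℂ} (hz : ‖z‖ < 1) :
    (ζ : ℂ) - z ≠ 0 := by
  have := norm_sub_sphere_ge ζ z
  exact norm_pos_iff.mp (by linarith)

lemma continuous_herglotz {z : ℂ} (hz : ‖z‖ < 1) :
    Continuous fun ζ : Metric.sphere (0 : ℂ) 1 => ((ζ : ℂ) + z) / ((ζ : ℂ) - z) :=
  Continuous.div (by fun_prop) (by fun_prop) fun ζ => sphere_sub_ne_zero ζ hz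

lemma integrable_herglotz (μ : Measure (Metric.sphere (0 : ℂ) 1)) [IsFiniteMeasure μ] {z : ℂ}
    (hz : ‖z‖ < 1) :
    Integrable (fun ζ : Metric.sphere (0 : ℂ) 1 => ((ζ : ℂ) + z) / ((ζ : ℂ) - z)) μ :=
  (continuous_herglotz hz).integrable_of_hasCompactSupport (HasCompactSupport.of_compactSpace _)

lemma poissonKernel_eq_re (z ζ : ℂ) : poissonKernel 0 z ζ = ((ζ + z) / (ζ - z)).re := by
  rw [poissonKernel_eq_re_herglotzRieszKernel]
  simp [herglotzRieszKernel_def]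

lemma poissonKernel_sphere (z : ℂ) (ζ : Metric.sphere (0 : ℂ) 1) :
    poissonKernel 0 z (ζ : ℂ) = (1 - ‖z‖ ^ 2) / ‖(ζ : ℂ) - z‖ ^ 2 := by
  have h1 : ‖(ζ : ℂ)‖ = 1 := by simp
  simp [poissonKernel_def, h1]

lemma poissonKernel_sphere_nonneg {z : ℂ} (hz : ‖z‖ < 1) (ζ : Metric.sphere (0 : ℂ) 1) :
    0 ≤ poissonKernel 0 z (ζ : ℂ) := by
  rw [poissonKernel_sphere]
  have : ‖z‖ ^ 2 ≤ 1 := pow_le_one₀ (norm_nonneg _) hz.le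
  exact div_nonneg (by linarith) (by positivity)

lemma continuous_poissonKernel_sphere {z : ℂ} (hz : ‖z‖ < 1) :
    Continuous fun ζ : Metric.sphere (0 : ℂ) 1 => poissonKernel 0 z (ζ : ℂ) := by
  simp only [poissonKernel_eq_re]
  exact continuous_re.comp (continuous_herglotz hz)

lemma norm_singularInner (μ : Measure (Metric.sphere (0 : ℂ) 1)) [IsFiniteMeasure μ] {z : ℂ}
    (hz : ‖z‖ < 1) :
    ‖singularInner μ z‖ = Real.exp (-∫ ζ, poissonKernel 0 z (ζ : ℂ) ∂μ) := by
  rw [singularInner, Complex.norm_exp, neg_re]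
  simp only [poissonKernel_eq_re]
  congr 2
  exact (integral_re (integrable_herglotz μ hz)).symm

lemma norm_singularInner_le_one (μ : Measure (Metric.sphere (0 : ℂ) 1)) [IsFiniteMeasure μ]
    {z : ℂ} (hz : ‖z‖ < 1) : ‖singularInner μ z‖ ≤ 1 := by
  rw [norm_singularInner μ hz, Real.exp_le_one_iff, neg_nonpos]
  exact integral_nonneg fun ζ => poissonKernel_sphere_nonneg hz ζ

lemma singularInner_ne_zero (μ : Measure (Metric.sphere (0 : ℂ) 1)) (z : ℂ) :
    singularInner μ z ≠ 0 := Complex.exp_ne_zero _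

lemma differentiableOn_singularInner (μ : Measure (Metric.sphere (0 : ℂ) 1)) [IsFiniteMeasure μ] :
    DifferentiableOn ℂ (singularInner μ) (Metric.ball 0 1) := by
  intro w hw
  have hw1 : ‖w‖ < 1 := by simpa using hw
  set d : ℝ := (1 - ‖w‖) / 2 with hd
  have hd0 : 0 < d := by rw [hd]; linarith
  have hball : ∀ x ∈ Metric.ball w d, ‖x‖ < 1 - d := by
    intro x hx
    rw [mem_ball_iff_norm] at hx
    have := norm_sub_norm_le x w
    linarith
  have key := (hasDerivAt_integral_of_dominated_loc_of_deriv_le (μ := μ)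
    (F := fun (x : ℂ) (ζ : Metric.sphere (0 : ℂ) 1) => ((ζ : ℂ) + x) / ((ζ : ℂ) - x))
    (F' := fun (x : ℂ) (ζ : Metric.sphere (0 : ℂ) 1) => (2 * (ζ : ℂ)) / ((ζ : ℂ) - x) ^ 2)
    (bound := fun _ => 2 * (d ^ 2)⁻¹)
    (Metric.ball_mem_nhds w hd0) ?_ (integrable_herglotz μ hw1) ?_ ?_ (integrable_const _) ?_).2
  · exact (key.neg.cexp.differentiableAt).differentiableWithinAt
  · filter_upwards [Metric.ball_mem_nhds w hd0] with x hx
    exact (continuous_herglotz ((hball x hx).trans (by linarith))).aestronglyMeasurable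
  · refine Continuous.aestronglyMeasurable (Continuous.div (by fun_prop) (by fun_prop) ?_)
    exact fun ζ => pow_ne_zero _ (sphere_sub_ne_zero ζ hw1)
  · refine Eventually.of_forall fun ζ x hx => ?_
    have h1 : ‖(ζ : ℂ)‖ = 1 := by simp
    have h2 : d ≤ ‖(ζ : ℂ) - x‖ := by
      have := norm_sub_sphere_ge ζ x
      have := hball x hx
      linarith
    rw [norm_div, norm_mul, norm_pow, h1, div_eq_mul_inv]
    simp only [RCLike.norm_ofNat, mul_one]
    gcongr
  · refine Eventually.of_forall fun ζ x hx => ?_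
    have h1 := sphere_sub_ne_zero ζ ((hball x hx).trans (by linarith))
    have h3 := ((hasDerivAt_id' x).const_add (ζ : ℂ)).div ((hasDerivAt_id' x).const_sub (ζ : ℂ)) h1
    simpa [sub_sub, ← two_mul, Pi.div_def] using h3

lemma singularInner_zero (z : ℂ) : singularInner 0 z = 1 := by
  simp [singularInner]

lemma singularInner_add (μ ν : Measure (Metric.sphere (0 : ℂ) 1)) [IsFiniteMeasure μ]
    [IsFiniteMeasure ν] {z : ℂ} (hz : ‖z‖ < 1) :
    singularInner (μ + ν) z = singularInner μ z * singularInner ν z := by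
  rw [singularInner, integral_add_measure (integrable_herglotz μ hz) (integrable_herglotz ν hz),
    neg_add, Complex.exp_add]
  rfl

end GrowthSpace

namespace GrowthSpace

open Complex

/-! ### Dyadic arcs and Poisson integrals -/

/-- The angle in `(0, 2π]` of a point of the unit circle. -/
noncomputable def angle (ζ : Metric.sphere (0 : ℂ) 1) : ℝ := arg (-(ζ : ℂ)) + Real.pi

/-- The index of the arc of length `2π / 2 ^ m` that contains the point with angle `θ`. -/
noncomputable def arcIndex (m : ℕ) (θ : ℝ) : ℕ := ⌈2 ^ m * (θ / (2 * Real.pi))⌉₊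

lemma angle_mem (ζ : Metric.sphere (0 : ℂ) 1) : angle ζ ∈ Ioc 0 (2 * Real.pi) := by
  have h1 := neg_pi_lt_arg (-(ζ : ℂ))
  have h2 := arg_le_pi (-(ζ : ℂ))
  constructor <;> rw [angle] <;> linarith

lemma circleMap_angle (ζ : Metric.sphere (0 : ℂ) 1) : circleMap 0 1 (angle ζ) = ζ := by
  have h1 : ‖-(ζ : ℂ)‖ = 1 := by simp
  have h2 := norm_mul_exp_arg_mul_I (-(ζ : ℂ))
  rw [h1] at h2
  simp only [circleMap, angle, ofReal_add, add_mul, Complex.exp_add, exp_pi_mul_I, zero_add]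
  rw [← mul_assoc, h2]
  simp

lemma measurable_angle : Measurable angle :=
  (measurable_arg.comp measurable_subtype_coe.neg).add_const _

lemma measurable_arcIndex (m : ℕ) : Measurable (arcIndex m) :=
  Nat.measurable_ceil.comp (by fun_prop)

/-- Dyadic arcs are nested: `⌈y⌉ ≤ i` iff `⌈2 ^ k * y⌉ ≤ 2 ^ k * i`, so the fine index determines
the coarse one. This supplies the refinement hypothesis of `exists_decomposition`. -/
lemma arcIndex_congr {m n : ℕ} (h : m ≤ n) {θ φ : ℝ} (hn : arcIndex n θ = arcIndex n φ) :
    arcIndex m θ = arcIndex m φ := by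
  obtain ⟨k, rfl⟩ := Nat.exists_eq_add_of_le h
  have key : ∀ (x : ℝ) (i : ℕ), arcIndex m x ≤ i ↔ arcIndex (m + k) x ≤ 2 ^ k * i := by
    intro x i
    rw [arcIndex, arcIndex, Nat.ceil_le, Nat.ceil_le, pow_add, mul_comm ((2 : ℝ) ^ m) (2 ^ k),
      mul_assoc ((2 : ℝ) ^ k)]
    push_cast
    exact (mul_le_mul_iff_right₀ (by positivity : (0 : ℝ) < 2 ^ k)).symm
  exact eq_of_forall_ge_iff fun i => by rw [key, key, hn]

lemma arcIndex_eq_iff {m i : ℕ} {θ : ℝ} :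
    arcIndex m θ = i + 1 ↔
      θ ∈ Ioc (2 * Real.pi * i / 2 ^ m) (2 * Real.pi * (i + 1) / 2 ^ m) := by
  have hpi := Real.pi_pos
  rw [arcIndex, Nat.ceil_eq_iff (by omega), mem_Ioc, Nat.add_sub_cancel, div_lt_iff₀ (by positivity),
    le_div_iff₀ (by positivity), mul_div_assoc', lt_div_iff₀ (by positivity),
    div_le_iff₀ (by positivity)]
  push_cast
  constructor <;> rintro ⟨h1, h2⟩ <;> constructor <;> linarith

lemma arcIndex_mem {m : ℕ} {θ : ℝ} (hθ : θ ∈ Ioc 0 (2 * Real.pi)) :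
    ∃ i < 2 ^ m, arcIndex m θ = i + 1 := by
  have hpi := Real.pi_pos
  have h1 : 0 < arcIndex m θ := Nat.ceil_pos.mpr (by have := hθ.1; positivity)
  have h2 : arcIndex m θ ≤ 2 ^ m := by
    rw [arcIndex, Nat.ceil_le]
    push_cast
    refine mul_le_of_le_one_right (by positivity) ?_
    rw [div_le_one (by positivity)]
    exact hθ.2
  exact ⟨arcIndex m θ - 1, by omega, by omega⟩

lemma norm_circleMap_sub_le (θ φ : ℝ) : ‖circleMap 0 1 θ - circleMap 0 1 φ‖ ≤ |θ - φ| := by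
  have := (lipschitzWith_circleMap 0 1).dist_le_mul θ φ
  simpa [dist_eq_norm] using this

/-- A Harnack-type bound in the boundary variable: moving the boundary point by at most `δ ≤ 1 -
‖z‖` at most doubles its distance to `z`, and the kernel depends on the inverse square of that
distance. -/
lemma poissonKernel_le_four_mul {z : ℂ} {δ : ℝ} (hδ : 0 < δ) (hz : ‖z‖ ≤ 1 - δ) {θ φ : ℝ}
    (h : |θ - φ| ≤ δ) :
    poissonKernel 0 z (circleMap 0 1 θ) ≤ 4 * poissonKernel 0 z (circleMap 0 1 φ) := by
  set a : Metric.sphere (0 : ℂ) 1 := ⟨circleMap 0 1 θ, by simp⟩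
  set b : Metric.sphere (0 : ℂ) 1 := ⟨circleMap 0 1 φ, by simp⟩
  change poissonKernel 0 z (a : ℂ) ≤ 4 * poissonKernel 0 z (b : ℂ)
  have ha := norm_sub_sphere_ge a z
  have hb := norm_sub_sphere_ge b z
  have hab : ‖(b : ℂ) - a‖ ≤ δ := by
    rw [norm_sub_rev]
    exact (norm_circleMap_sub_le θ φ).trans h
  have htri : ‖(b : ℂ) - z‖ ≤ 2 * ‖(a : ℂ) - z‖ := by
    have := norm_add_le ((b : ℂ) - a) ((a : ℂ) - z)
    rw [sub_add_sub_cancel] at this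
    linarith
  have hz2 : ‖z‖ ^ 2 ≤ 1 := pow_le_one₀ (norm_nonneg _) (by linarith)
  rw [poissonKernel_sphere, poissonKernel_sphere, mul_div_assoc', div_le_div_iff₀
    (by have : 0 < ‖(a : ℂ) - z‖ := by linarith
        positivity)
    (by have : 0 < ‖(b : ℂ) - z‖ := by linarith
        positivity)]
  have : ‖(b : ℂ) - z‖ ^ 2 ≤ 4 * ‖(a : ℂ) - z‖ ^ 2 := by
    calc ‖(b : ℂ) - z‖ ^ 2 ≤ (2 * ‖(a : ℂ) - z‖) ^ 2 := by gcongr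
      _ = _ := by ring
  nlinarith [mul_le_mul_of_nonneg_left this (sub_nonneg.mpr hz2)]

lemma continuous_poissonKernel_circleMap {z : ℂ} (hz : ‖z‖ < 1) :
    Continuous fun θ : ℝ => poissonKernel 0 z (circleMap 0 1 θ) := by
  have hc := continuous_circleMap 0 1
  simp only [poissonKernel_def, sub_zero]
  refine Continuous.div (by fun_prop) (by fun_prop) fun θ => pow_ne_zero _ (norm_ne_zero_iff.mpr ?_)
  exact sphere_sub_ne_zero ⟨circleMap 0 1 θ, by simp⟩ hz

lemma integral_poissonKernel_circleMap {z : ℂ} (hz : ‖z‖ < 1) :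
    ∫ θ in (0 : ℝ)..(2 * Real.pi), poissonKernel 0 z (circleMap 0 1 θ) = 2 * Real.pi := by
  have h := (diffContOnCl_const (𝕜 := ℂ) (c := (1 : ℂ)) (s := Metric.ball (0 : ℂ) 1)
    ).circleAverage_poissonKernel_smul (w := z) (by simpa using hz)
  rw [Real.circleAverage_def] at h
  have h2 : (∫ θ in (0 : ℝ)..(2 * Real.pi),
      (poissonKernel 0 z • fun _ => (1 : ℂ)) (circleMap 0 1 θ))
      = ((∫ θ in (0 : ℝ)..(2 * Real.pi), poissonKernel 0 z (circleMap 0 1 θ) : ℝ) : ℂ) := by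
    rw [← intervalIntegral.integral_ofReal]
    simp
  rw [h2] at h
  have hpi := Real.pi_pos
  have h3 : ((2 * Real.pi)⁻¹ * ∫ θ in (0 : ℝ)..(2 * Real.pi),
      poissonKernel 0 z (circleMap 0 1 θ)) = 1 := by
    have := congrArg re h
    simpa using this
  field_simp at h3
  linarith

/-- If every dyadic arc of length `2π / 2 ^ m ≤ δ` has mass at most `c`, the Poisson integral is at
most `4 * 2 ^ m * c` on the disc of radius `1 - δ`. -/
lemma integral_poissonKernel_le {ν : Measure (Metric.sphere (0 : ℂ) 1)} [IsFiniteMeasure ν]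
    {m : ℕ} {c δ : ℝ} (hδ : 0 < δ) (hm : 2 * Real.pi ≤ δ * 2 ^ m)
    (hν : ∀ i, ν.real {ζ | arcIndex m (angle ζ) = i} ≤ c) {z : ℂ} (hz : ‖z‖ ≤ 1 - δ) :
    ∫ ζ, poissonKernel 0 z (ζ : ℂ) ∂ν ≤ 4 * 2 ^ m * c := by
  have hpi := Real.pi_pos
  have hz1 : ‖z‖ < 1 := by linarith
  have hc : 0 ≤ c := measureReal_nonneg.trans (hν 0)
  set P : ℝ → ℝ := fun θ => poissonKernel 0 z (circleMap 0 1 θ) with hP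
  have hPc : Continuous P := continuous_poissonKernel_circleMap hz1
  set a : ℕ → ℝ := fun i => 2 * Real.pi * i / 2 ^ m with ha
  set S : ℕ → Set (Metric.sphere (0 : ℂ) 1) := fun i => {ζ | arcIndex m (angle ζ) = i + 1} with hS
  have hSmeas : ∀ i, MeasurableSet (S i) := fun i =>
    ((measurable_arcIndex m).comp measurable_angle) (measurableSet_singleton (i + 1))
  have hint : Integrable (fun ζ : Metric.sphere (0 : ℂ) 1 => poissonKernel 0 z (ζ : ℂ)) ν :=
    (continuous_poissonKernel_sphere hz1).integrable_of_hasCompactSupport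
      (HasCompactSupport.of_compactSpace _)
  have hlen : ∀ i, a (i + 1) - a i = 2 * Real.pi / 2 ^ m := by
    intro i
    simp only [ha]
    push_cast
    ring
  have hlen0 : 0 < 2 * Real.pi / 2 ^ m := by positivity
  have hcell : ∀ i, ∫ ζ in S i, poissonKernel 0 z (ζ : ℂ) ∂ν
      ≤ c * (4 * 2 ^ m / (2 * Real.pi)) * ∫ θ in (a i)..(a (i + 1)), P θ := by
    intro i
    have hI0 : 0 ≤ ∫ θ in (a i)..(a (i + 1)), P θ := by
      refine intervalIntegral.integral_nonneg (by linarith [hlen i]) fun θ _ => ?_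
      exact poissonKernel_sphere_nonneg hz1 ⟨circleMap 0 1 θ, by simp⟩
    have hpt : ∀ ζ ∈ S i, poissonKernel 0 z (ζ : ℂ)
        ≤ (4 * 2 ^ m / (2 * Real.pi)) * ∫ θ in (a i)..(a (i + 1)), P θ := by
      intro ζ hζ
      have hζ' := arcIndex_eq_iff.mp hζ
      -- Averaging the Harnack bound over the arc of `ζ` replaces the kernel at `ζ` by four times
      -- its mean for arc length. Summed over arcs, these means recover the total Poisson mass `2π`.
      have hmono : ∫ θ in (a i)..(a (i + 1)), poissonKernel 0 z (ζ : ℂ)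
          ≤ ∫ θ in (a i)..(a (i + 1)), 4 * P θ := by
        refine intervalIntegral.integral_mono_on (by linarith [hlen i]) (by simp)
          ((continuous_const.mul hPc).intervalIntegrable _ _) fun θ hθ => ?_
        rw [← circleMap_angle ζ]
        refine poissonKernel_le_four_mul hδ hz ?_
        have h1 : 2 * Real.pi / 2 ^ m ≤ δ := by
          rwa [div_le_iff₀ (by positivity)]
        have h2 := hlen i
        simp only [ha] at h2 hθ
        push_cast at h2 hθ
        rw [abs_le]
        constructor <;> linarith [hζ'.1, hζ'.2, hθ.1, hθ.2]
      rw [intervalIntegral.integral_const, intervalIntegral.integral_const_mul, hlen,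
        smul_eq_mul, div_mul_eq_mul_div, div_le_iff₀ (by positivity)] at hmono
      rw [div_mul_eq_mul_div, le_div_iff₀ (by positivity)]
      linarith
    calc ∫ ζ in S i, poissonKernel 0 z (ζ : ℂ) ∂ν
        ≤ ∫ _ in S i, ((4 * 2 ^ m / (2 * Real.pi)) * ∫ θ in (a i)..(a (i + 1)), P θ) ∂ν :=
          setIntegral_mono_on hint.integrableOn (integrable_const _) (hSmeas i) hpt
      _ = ν.real (S i) * ((4 * 2 ^ m / (2 * Real.pi)) * ∫ θ in (a i)..(a (i + 1)), P θ) := by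
          rw [setIntegral_const, smul_eq_mul]
      _ ≤ c * ((4 * 2 ^ m / (2 * Real.pi)) * ∫ θ in (a i)..(a (i + 1)), P θ) := by
          gcongr
          exact hν (i + 1)
      _ = _ := by ring
  have hunion : (⋃ i ∈ Finset.range (2 ^ m), S i) = univ := by
    ext ζ
    obtain ⟨i, hi, h⟩ := arcIndex_mem (m := m) (angle_mem ζ)
    simp only [mem_iUnion, mem_univ, iff_true]
    exact ⟨i, Finset.mem_range.mpr hi, h⟩
  have hdisj : (↑(Finset.range (2 ^ m)) : Set ℕ).Pairwise (Function.onFun Disjoint S) := by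
    intro i _ j _ hij
    rw [Function.onFun, Set.disjoint_left]
    intro ζ h1 h2
    simp only [hS, mem_ofPred_eq] at h1 h2
    omega
  have hsum : ∑ i ∈ Finset.range (2 ^ m), ∫ θ in (a i)..(a (i + 1)), P θ = 2 * Real.pi := by
    rw [intervalIntegral.sum_integral_adjacent_intervals
      fun k _ => hPc.intervalIntegrable _ _]
    have h0 : a 0 = 0 := by simp [ha]
    have h1 : a (2 ^ m) = 2 * Real.pi := by simp [ha]
    rw [h0, h1, integral_poissonKernel_circleMap hz1]
  calc ∫ ζ, poissonKernel 0 z (ζ : ℂ) ∂ν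
      = ∑ i ∈ Finset.range (2 ^ m), ∫ ζ in S i, poissonKernel 0 z (ζ : ℂ) ∂ν := by
        rw [← integral_biUnion_finset _ (fun i _ => hSmeas i) hdisj fun i _ => hint.integrableOn,
          hunion, setIntegral_univ]
    _ ≤ ∑ i ∈ Finset.range (2 ^ m),
        c * (4 * 2 ^ m / (2 * Real.pi)) * ∫ θ in (a i)..(a (i + 1)), P θ :=
        Finset.sum_le_sum fun i _ => hcell i
    _ = 4 * 2 ^ m * c := by
        rw [← Finset.mul_sum, hsum]
        field_simp

end GrowthSpace

namespace GrowthSpace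

/-! ### Decomposition of a measure along refining partitions -/

section Decomposition

variable {X : Type*} [MeasurableSpace X]

lemma withDensity_comp_fiber (ρ : Measure X) {p : X → ℕ} (hp : Measurable p) (r : ℕ → ℝ≥0∞)
    (i : ℕ) : ρ.withDensity (fun x => r (p x)) (p ⁻¹' {i}) = r i * ρ (p ⁻¹' {i}) := by
  have hs : MeasurableSet (p ⁻¹' {i}) := hp (measurableSet_singleton i)
  rw [withDensity_apply _ hs, ← setLIntegral_const]
  refine setLIntegral_congr_fun hs fun x hx => ?_
  rw [show p x = i from hx]

/-- On each cell keep the fraction of `ρ` that brings the mass down to `c`, or all of it if the mass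
is already at most `c`. Both parts have densities constant on cells. -/
lemma exists_capped_part (ρ : Measure X) [IsFiniteMeasure ρ] {p : X → ℕ} (hp : Measurable p)
    {c M : ℝ≥0∞} (hM : ∀ i, ρ (p ⁻¹' {i}) ≤ M) :
    ∃ ν ρ' : Measure X, ρ = ν + ρ' ∧ (∀ i, ν (p ⁻¹' {i}) ≤ c) ∧
      ∀ i, ρ' (p ⁻¹' {i}) ≤ M - c := by
  set r : ℕ → ℝ≥0∞ := fun i => if ρ (p ⁻¹' {i}) ≤ c then 1 else c / ρ (p ⁻¹' {i}) with hr
  have hr1 : ∀ i, r i ≤ 1 := by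
    intro i
    simp only [hr]
    split_ifs with h
    · exact le_rfl
    · exact ENNReal.div_le_of_le_mul (by simpa using (not_le.mp h).le)
  have hν : ∀ i, r i * ρ (p ⁻¹' {i}) = min c (ρ (p ⁻¹' {i})) := by
    intro i
    simp only [hr]
    split_ifs with h
    · simp [h]
    · rw [not_le] at h
      rw [ENNReal.div_mul_cancel (ne_zero_of_lt h) (measure_ne_top _ _), min_eq_left h.le]
  refine ⟨ρ.withDensity fun x => r (p x), ρ.withDensity fun x => 1 - r (p x), ?_, ?_, ?_⟩
  · have hm : Measurable fun x => r (p x) := (measurable_from_nat (f := r)).comp hp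
    rw [← withDensity_add_left hm]
    have : ((fun x => r (p x)) + fun x => 1 - r (p x)) = 1 := by
      ext x
      simp [add_tsub_cancel_of_le (hr1 _)]
    rw [this, withDensity_one]
  · intro i
    rw [withDensity_comp_fiber ρ hp, hν]
    exact min_le_left _ _
  · intro i
    rw [withDensity_comp_fiber ρ hp (fun k => 1 - r k),
      ENNReal.sub_mul fun _ _ => measure_ne_top _ _, one_mul, hν]
    rcases le_total c (ρ (p ⁻¹' {i})) with h | h
    · rw [min_eq_left h]
      exact tsub_le_tsub_right (hM i) c
    · simp [min_eq_right h]

/-- Greedy induction: cap the remainder on the cells of `p n`, which lowers its largest possible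
cell mass by `c n`. The bound passes to every later partition because finer cells lie inside coarser
ones. -/
lemma exists_decomposition_add (μ : Measure X) [IsFiniteMeasure μ] {p : ℕ → X → ℕ}
    (hp : ∀ j, Measurable (p j))
    (href : ∀ j k, j ≤ k → ∀ x y, p k x = p k y → p j x = p j y) (c : ℕ → ℝ≥0∞) (n : ℕ) :
    ∃ (ν : ℕ → Measure X) (ρ : Measure X), μ = ∑ j ∈ Finset.range n, ν j + ρ ∧
      (∀ j < n, ∀ i, ν j (p j ⁻¹' {i}) ≤ c j) ∧
      ∀ k, n ≤ k → ∀ i, ρ (p k ⁻¹' {i}) ≤ μ univ - ∑ j ∈ Finset.range n, c j := by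
  induction n with
  | zero =>
    exact ⟨fun _ => 0, μ, by simp, by simp, fun k _ i => by simpa using measure_mono (subset_univ _)⟩
  | succ n ih =>
    obtain ⟨ν, ρ, hμ, hν, hρ⟩ := ih
    have hle : ρ ≤ μ := by
      rw [hμ]
      exact Measure.le_add_left le_rfl
    have : IsFiniteMeasure ρ := isFiniteMeasure_of_le μ hle
    obtain ⟨ν', ρ', h1, h2, h3⟩ := exists_capped_part ρ (hp n) (c := c n) (hρ n le_rfl)
    refine ⟨Function.update ν n ν', ρ', ?_, ?_, ?_⟩
    · rw [Finset.sum_range_succ, Function.update_self, add_assoc, ← h1, hμ]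
      congr 1
      refine Finset.sum_congr rfl fun j hj => ?_
      rw [Function.update_of_ne (Finset.mem_range.mp hj).ne]
    · intro j hj i
      rcases Nat.lt_succ_iff_lt_or_eq.mp hj with h | rfl
      · rw [Function.update_of_ne h.ne]
        exact hν j h i
      · rw [Function.update_self]
        exact h2 i
    · intro k hk i
      rw [Finset.sum_range_succ, ← tsub_tsub]
      rcases (p k ⁻¹' {i}).eq_empty_or_nonempty with h | ⟨x, hx⟩
      · simp [h]
      · refine le_trans (measure_mono fun y hy => ?_) (h3 (p n x))
        have hxy : p k y = p k x := by
          rw [mem_preimage, mem_singleton_iff] at hx hy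
          rw [hx, hy]
        exact href n k (by omega) y x hxy

/-- A finite measure splits into finitely many parts, the `j`-th of which has mass at most `c j` on
every cell of the `j`-th of a sequence of refining partitions, once `∑ c j` exceeds its mass. -/
lemma exists_decomposition (μ : Measure X) [IsFiniteMeasure μ] {p : ℕ → X → ℕ}
    (hp : ∀ j, Measurable (p j))
    (href : ∀ j k, j ≤ k → ∀ x y, p k x = p k y → p j x = p j y) {c : ℕ → ℝ≥0∞} {n : ℕ}
    (hc : μ univ ≤ ∑ j ∈ Finset.range n, c j) :
    ∃ ν : ℕ → Measure X, μ = ∑ j ∈ Finset.range n, ν j ∧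
      ∀ j < n, ∀ i, ν j (p j ⁻¹' {i}) ≤ c j := by
  obtain ⟨ν, ρ, hμ, hν, hρ⟩ := exists_decomposition_add μ hp href c n
  refine ⟨ν, ?_, hν⟩
  suffices ρ = 0 by rw [hμ, this, add_zero]
  rw [← Measure.measure_univ_eq_zero, show (univ : Set X) = ⋃ i, p n ⁻¹' {i} by ext; simp,
    measure_iUnion_null_iff]
  intro i
  simpa [tsub_eq_zero_of_le hc] using hρ n le_rfl i

end Decomposition

end GrowthSpace

namespace GrowthSpace

open Polynomial

/-! ### Taylor polynomials of reciprocals -/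

/-- One coefficient sequence serves both the expansion on the whole disc and the Cauchy estimates at
every radius. -/
lemma exists_taylor_coeff {F : ℂ → ℂ} (hF : DifferentiableOn ℂ F (Metric.ball 0 1)) :
    ∃ c : ℕ → ℂ, (∀ z : ℂ, ‖z‖ < 1 → HasSum (fun n => c n * z ^ n) (F z)) ∧
      ∀ r K : ℝ, 0 < r → r < 1 → (∀ z : ℂ, ‖z‖ = r → ‖F z‖ ≤ K) → ∀ n, ‖c n‖ ≤ K / r ^ n := by
  refine ⟨fun n => (n.factorial : ℂ)⁻¹ * iteratedDeriv n F 0, fun z hz => ?_,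
    fun r K hr hr1 hK n => ?_⟩
  · have h := Complex.hasSum_taylorSeries_on_ball hF (z := z) (by simpa using hz)
    refine h.congr_fun fun n => ?_
    simp only [sub_zero, smul_eq_mul]
    ring
  · have hd : DiffContOnCl ℂ F (Metric.ball 0 r) := by
      refine DifferentiableOn.diffContOnCl (hF.mono ?_)
      rw [closure_ball _ hr.ne']
      exact Metric.closedBall_subset_ball hr1
    have h := Complex.norm_iteratedDeriv_le_of_forall_mem_sphere_norm_le n hr hd
      (fun z hz => hK z (by simpa using hz))
    have hf : (0 : ℝ) < n.factorial := by exact_mod_cast n.factorial_pos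
    rw [norm_mul, norm_inv, Complex.norm_natCast, inv_mul_le_iff₀ hf]
    rwa [mul_div_assoc] at h

lemma one_sub_inv_le_exp {δ : ℝ} (h0 : 0 ≤ δ) (h : δ ≤ 1 / 2) : (1 - δ)⁻¹ ≤ Real.exp (2 * δ) := by
  have h1 : (1 - δ)⁻¹ ≤ 2 * δ + 1 := by
    rw [inv_le_iff_one_le_mul₀ (by linarith)]
    nlinarith
  exact h1.trans (Real.add_one_le_exp _)

/-- If `1 / Θ` is at most `exp x` for `‖z‖ ≤ 1 - δ`, then its Taylor polynomial `f` of degree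
less than `x / δ` makes `Θ f` close to `1` well inside that disc, and not too large near the
circle. -/
lemma exists_polynomial_mul_near_one {Θ : ℂ → ℂ} (hΘ : DifferentiableOn ℂ Θ (Metric.ball 0 1))
    (h0 : ∀ z, Θ z ≠ 0) (h1 : ∀ z : ℂ, ‖z‖ < 1 → ‖Θ z‖ ≤ 1) {δ x : ℝ} (hδ : 0 < δ)
    (hδ2 : δ ≤ 1 / 2) (hx : 0 ≤ x)
    (hlow : ∀ z : ℂ, ‖z‖ ≤ 1 - δ → Real.exp (-x) ≤ ‖Θ z‖)
    (hlarge : (x / δ + 1) * Real.exp 1 + 1 ≤ Real.exp x) (hδx : 1 / δ ≤ Real.exp x) :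
    ∃ f : ℂ[X], (∀ z : ℂ, ‖z‖ < 1 → ‖f.eval z * Θ z‖ ≤ Real.exp (4 * x)) ∧
      (∀ z : ℂ, ‖z‖ < 1 → ‖1 - f.eval z * Θ z‖ ≤ Real.exp (4 * x)) ∧
      ∀ z : ℂ, ‖z‖ ≤ 1 - 16 * δ → ‖1 - f.eval z * Θ z‖ ≤ Real.exp (-8 * x) := by
  obtain ⟨c, hsum, hcoeff⟩ := exists_taylor_coeff (F := fun z => (Θ z)⁻¹)
    (hΘ.inv fun z _ => h0 z)
  have hr0 : 0 < 1 - δ := by linarith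
  have hc : ∀ n, ‖c n‖ ≤ Real.exp x / (1 - δ) ^ n := by
    refine hcoeff (1 - δ) (Real.exp x) hr0 (by linarith) fun z hz => ?_
    rw [norm_inv, ← inv_inv (Real.exp x), ← Real.exp_neg]
    exact inv_anti₀ (Real.exp_pos _) (hlow z hz.le)
  -- The degree balances two demands: `(1 - δ)⁻¹ ^ N ≤ exp (2x + 1)` keeps the polynomial moderate
  -- up to the circle, while `(1 - 15δ) ^ N ≤ exp (-15x)` kills the Taylor tail inside.
  set N : ℕ := ⌈x / δ⌉₊ with hN
  have hN1 : x / δ ≤ N := Nat.le_ceil _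
  have hN2 : (N : ℝ) < x / δ + 1 := Nat.ceil_lt_add_one (by positivity)
  have hN3 : x ≤ δ * N := by rwa [div_le_iff₀ hδ, mul_comm] at hN1
  have hN4 : δ * N ≤ x + 1 / 2 := by
    have : δ * N ≤ δ * (x / δ + 1) := by gcongr
    rw [mul_add, mul_div_cancel₀ _ hδ.ne'] at this
    linarith
  set f : ℂ[X] := ∑ n ∈ Finset.range N, C (c n) * X ^ n with hf
  have hfeval : ∀ z, f.eval z = ∑ n ∈ Finset.range N, c n * z ^ n := by
    intro z
    simp [hf, eval_finsetSum]
  have hbound : ∀ z : ℂ, ‖z‖ < 1 → ‖f.eval z * Θ z‖ ≤ N * Real.exp (3 * x + 1) := by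
    intro z hz
    rw [norm_mul]
    refine (mul_le_of_le_one_right (norm_nonneg _) (h1 z hz)).trans ?_
    rw [hfeval]
    refine (norm_sum_le _ _).trans ?_
    have : ∀ n ∈ Finset.range N, ‖c n * z ^ n‖ ≤ Real.exp (3 * x + 1) := by
      intro n hn
      have hn' : n ≤ N := (Finset.mem_range.mp hn).le
      calc ‖c n * z ^ n‖ ≤ ‖c n‖ := by
            rw [norm_mul, norm_pow]
            exact mul_le_of_le_one_right (norm_nonneg _) (pow_le_one₀ (norm_nonneg _) hz.le)
        _ ≤ Real.exp x * ((1 - δ)⁻¹) ^ n := by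
            rw [inv_pow, ← div_eq_mul_inv]
            exact hc n
        _ ≤ Real.exp x * ((1 - δ)⁻¹) ^ N := by
            gcongr
            rw [one_le_inv₀ hr0]
            linarith
        _ ≤ Real.exp x * (Real.exp (2 * δ)) ^ N := by
            gcongr
            exact one_sub_inv_le_exp hδ.le hδ2
        _ = Real.exp (x + N * (2 * δ)) := by rw [Real.exp_add, ← Real.exp_nat_mul]
        _ ≤ Real.exp (3 * x + 1) := Real.exp_le_exp.mpr (by nlinarith)
    refine (Finset.sum_le_card_nsmul _ _ _ this).trans ?_
    simp
  have hNexp : 1 + N * Real.exp (3 * x + 1) ≤ Real.exp (4 * x) := by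
    have e1 : Real.exp (3 * x + 1) = Real.exp (3 * x) * Real.exp 1 := Real.exp_add _ _
    have e2 : Real.exp (4 * x) = Real.exp (3 * x) * Real.exp x := by
      rw [← Real.exp_add]
      ring_nf
    have e3 : 1 ≤ Real.exp (3 * x) := Real.one_le_exp (by linarith)
    calc 1 + N * Real.exp (3 * x + 1)
        ≤ Real.exp (3 * x) + (x / δ + 1) * (Real.exp (3 * x) * Real.exp 1) := by
          rw [e1]
          gcongr
      _ = Real.exp (3 * x) * ((x / δ + 1) * Real.exp 1 + 1) := by ring
      _ ≤ Real.exp (4 * x) := by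
          rw [e2]
          gcongr
  refine ⟨f, fun z hz => (hbound z hz).trans (by linarith), fun z hz => ?_, fun z hz => ?_⟩
  · refine (norm_sub_le _ _).trans ?_
    rw [norm_one]
    linarith [hbound z hz]
  · have hz1 : ‖z‖ < 1 := by linarith
    set q : ℝ := ‖z‖ / (1 - δ) with hq
    have hq0 : 0 ≤ q := by positivity
    have hq15 : q ≤ 1 - 15 * δ := by
      rw [hq, div_le_iff₀ hr0]
      nlinarith
    have hq1 : q < 1 := by linarith
    have htail := (hasSum_nat_add_iff' N).mpr (hsum z hz1)
    rw [← hfeval] at htail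
    have hgeo : HasSum (fun n : ℕ => Real.exp x * q ^ N * q ^ n)
        (Real.exp x * q ^ N * (1 - q)⁻¹) := (hasSum_geometric_of_lt_one hq0 hq1).mul_left _
    have hle : ‖(Θ z)⁻¹ - f.eval z‖ ≤ Real.exp x * q ^ N * (1 - q)⁻¹ := by
      rw [← htail.tsum_eq]
      refine tsum_of_norm_bounded hgeo fun n => ?_
      rw [norm_mul, norm_pow]
      calc ‖c (n + N)‖ * ‖z‖ ^ (n + N) ≤ Real.exp x / (1 - δ) ^ (n + N) * ‖z‖ ^ (n + N) := by
            gcongr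
            exact hc _
        _ = _ := by
            rw [hq, div_mul_eq_mul_div, mul_div_assoc, ← div_pow, pow_add]
            ring
    have hqN : q ^ N ≤ Real.exp (-(15 * x)) := by
      calc q ^ N ≤ (Real.exp (-(15 * δ))) ^ N := by
            gcongr
            exact hq15.trans (Real.one_sub_le_exp_neg _)
        _ = Real.exp (N * -(15 * δ)) := (Real.exp_nat_mul _ _).symm
        _ ≤ _ := Real.exp_le_exp.mpr (by nlinarith)
    have hqinv : (1 - q)⁻¹ ≤ Real.exp x := by
      refine le_trans ?_ hδx
      rw [one_div]
      exact inv_anti₀ hδ (by linarith)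
    have heq : 1 - f.eval z * Θ z = ((Θ z)⁻¹ - f.eval z) * Θ z := by
      rw [sub_mul, inv_mul_cancel₀ (h0 z)]
    rw [heq, norm_mul]
    refine (mul_le_of_le_one_right (norm_nonneg _) (h1 z hz1)).trans (hle.trans ?_)
    calc Real.exp x * q ^ N * (1 - q)⁻¹ ≤ Real.exp x * Real.exp (-(15 * x)) * Real.exp x := by
          gcongr
      _ = Real.exp (-13 * x) := by
          rw [← Real.exp_add, ← Real.exp_add]
          ring_nf
      _ ≤ Real.exp (-8 * x) := Real.exp_le_exp.mpr (by linarith)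

end GrowthSpace

namespace GrowthSpace

open Polynomial

/-! ### Scales of a good weight -/

section Weight

variable {W : ℝ → ℝ}

lemma IsGoodWeight.log_antitone (hW : IsGoodWeight W) {s t : ℝ} (hs : 0 < s) (hst : s ≤ t)
    (ht : t ≤ 1) : Real.log (1 / W t) ≤ Real.log (1 / W s) := by
  have h1 : s ∈ Ioc (0 : ℝ) 1 := ⟨hs, hst.trans ht⟩
  have h2 : t ∈ Ioc (0 : ℝ) 1 := ⟨hs.trans_le hst, ht⟩
  have := (hW.mapsTo h1).1
  have := (hW.mapsTo h2).1
  exact Real.log_le_log (by positivity) (one_div_le_one_div_of_le ‹0 < W s› (hW.monotoneOn h1 h2 hst))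

lemma IsGoodWeight.eq_exp_neg (hW : IsGoodWeight W) {t : ℝ} (ht : t ∈ Ioc (0 : ℝ) 1) :
    W t = Real.exp (-Real.log (1 / W t)) := by
  rw [one_div, Real.log_inv, neg_neg, Real.exp_log (hW.mapsTo ht).1]

lemma IsGoodWeight.tendsto_log (hW : IsGoodWeight W) :
    Tendsto (fun t => Real.log (1 / W t)) (𝓝[>] 0) atTop := by
  refine Real.tendsto_log_atTop.comp ?_
  simp only [one_div]
  refine tendsto_inv_nhdsGT_zero.comp (tendsto_nhdsWithin_iff.mpr ⟨hW.tendsto_zero, ?_⟩)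
  filter_upwards [Ioc_mem_nhdsGT (zero_lt_one' ℝ)] with t ht
  exact (hW.mapsTo ht).1

lemma IsGoodWeight.exists_scale (hW : IsGoodWeight W) {y : ℝ} (hy : Real.log (1 / W 1) ≤ y) :
    ∃ δ ∈ Ioc (0 : ℝ) 1, Real.log (1 / W δ) = y := by
  obtain ⟨s, hsy, hs⟩ := ((hW.tendsto_log.eventually_ge_atTop y).and
    (Ioc_mem_nhdsGT (zero_lt_one' ℝ))).exists
  have hc : ContinuousOn (fun t => Real.log (1 / W t)) (Icc s 1) := by
    have hsub : Icc s 1 ⊆ Ioc 0 1 := fun t ht => ⟨hs.1.trans_le ht.1, ht.2⟩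
    refine ContinuousOn.log (continuousOn_const.div (hW.continuousOn.mono hsub) fun t ht => ?_)
      fun t ht => ?_
    · exact (hW.mapsTo (hsub ht)).1.ne'
    · exact one_div_ne_zero (hW.mapsTo (hsub ht)).1.ne'
  obtain ⟨δ, hδ, h⟩ := intermediate_value_Icc' hs.2 hc ⟨hy, hsy⟩
  exact ⟨δ, ⟨hs.1.trans_le hδ.1, hδ.2⟩, h⟩

lemma IsGoodWeight.lt_of_log_lt (hW : IsGoodWeight W) {s t : ℝ} (hs : 0 < s) (ht : t ≤ 1)
    (h : Real.log (1 / W s) < Real.log (1 / W t)) : t < s := by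
  by_contra! hst
  exact absurd (hW.log_antitone hs hst ht) (not_le.mpr h)

lemma IsGoodWeight.eventually_scale_lt (hW : IsGoodWeight W) {s : ℝ} (hs : 0 < s) :
    ∀ᶠ j : ℕ in atTop, ∀ δ ≤ 1, Real.log (1 / W δ) = 2 ^ j → δ < s := by
  filter_upwards [(tendsto_pow_atTop_atTop_of_one_lt (one_lt_two (α := ℝ))).eventually_gt_atTop
    (Real.log (1 / W s))] with j hj δ hδ h
  exact hW.lt_of_log_lt hs hδ (by rwa [h])

/-- Divergence of `∫ log (1 / W)` in terms of the scales `δ j` with `log (1 / W (δ j)) = 2 ^ j`. -/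
lemma not_summable_scales (hW : IsGoodWeight W) (hdiv : LogIntegralDiverges W) {δ : ℕ → ℝ} {k : ℕ}
    (hδ : ∀ j ≥ k, δ j ∈ Ioc (0 : ℝ) 1 ∧ Real.log (1 / W (δ j)) = 2 ^ j) :
    ¬ Summable fun j => 2 ^ (j + k) * δ (j + k) := by
  intro hsum
  have hnn : ∀ j, 0 ≤ 2 ^ (j + k) * δ (j + k) := fun j => by
    have := (hδ (j + k) (by omega)).1.1
    positivity
  -- Dyadic layers: if `2 ^ (j + k) < log (1 / W t) ≤ 2 * 2 ^ (j + k)`, then `t < δ (j + k)`, so the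
  -- `j`-th indicator alone dominates. Values up to `2 ^ k` go into the constant.
  have hpt : ∀ t ∈ Ioc (0 : ℝ) 1, ENNReal.ofReal (Real.log (1 / W t)) ≤ ENNReal.ofReal (2 ^ k) +
      ∑' j : ℕ, (Iic (δ (j + k))).indicator (fun _ => ENNReal.ofReal (2 * 2 ^ (j + k))) t := by
    intro t ht
    rcases le_or_gt (Real.log (1 / W t)) (2 ^ k) with h | h
    · exact le_add_right (ENNReal.ofReal_le_ofReal h)
    · have hex : ∃ j : ℕ, Real.log (1 / W t) ≤ 2 * 2 ^ (j + k) := by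
        obtain ⟨n, hn⟩ := pow_unbounded_of_one_lt (Real.log (1 / W t)) (one_lt_two (α := ℝ))
        refine ⟨n, hn.le.trans ?_⟩
        rw [pow_add]
        have h1 : (1 : ℝ) ≤ 2 ^ k := one_le_pow₀ one_le_two
        have h2 : (0 : ℝ) < 2 ^ n := by positivity
        nlinarith
      classical
      obtain ⟨j, hj, hlow⟩ : ∃ j : ℕ, Real.log (1 / W t) ≤ 2 * 2 ^ (j + k) ∧
          2 ^ (j + k) < Real.log (1 / W t) := by
        refine ⟨Nat.find hex, Nat.find_spec hex, ?_⟩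
        rcases Nat.eq_zero_or_pos (Nat.find hex) with h0 | h0
        · rw [h0, zero_add]
          exact h
        · have := Nat.find_min hex (Nat.sub_one_lt_of_lt h0)
          rw [not_le, ← pow_succ'] at this
          rwa [show Nat.find hex - 1 + k + 1 = Nat.find hex + k by omega] at this
      have htδ : t < δ (j + k) := by
        obtain ⟨h1, h2⟩ := hδ (j + k) (by omega)
        exact hW.lt_of_log_lt h1.1 ht.2 (by rwa [h2])
      refine le_add_left (le_trans ?_ (ENNReal.le_tsum j))
      rw [indicator_of_mem (mem_Iic.mpr htδ.le)]
      exact ENNReal.ofReal_le_ofReal hj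
  have hle : ∫⁻ t in Ioc (0 : ℝ) 1, ENNReal.ofReal (Real.log (1 / W t)) ≤ ENNReal.ofReal (2 ^ k) +
      ∑' j : ℕ, ENNReal.ofReal (2 * (2 ^ (j + k) * δ (j + k))) := by
    refine (setLIntegral_mono' measurableSet_Ioc hpt).trans ?_
    rw [lintegral_add_left measurable_const, lintegral_tsum fun j =>
      (measurable_const.indicator measurableSet_Iic).aemeasurable]
    refine add_le_add (by simp) (ENNReal.tsum_le_tsum fun j => ?_)
    have h1 := (hδ (j + k) (by omega)).1
    rw [lintegral_indicator_const measurableSet_Iic, Measure.restrict_apply measurableSet_Iic,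
      ← mul_assoc, ENNReal.ofReal_mul (p := 2 * 2 ^ (j + k)) (by positivity)]
    refine mul_le_mul_right ?_ _
    refine (measure_mono (t := Ioc 0 (δ (j + k))) fun t ht => ⟨ht.2.1, ht.1⟩).trans ?_
    simp
  rw [LogIntegralDiverges] at hdiv
  rw [hdiv, top_le_iff, ← ENNReal.ofReal_tsum_of_nonneg (fun j => by have := hnn j; positivity)
    (hsum.mul_left 2)] at hle
  exact ENNReal.add_ne_top.mpr ⟨ENNReal.ofReal_ne_top, ENNReal.ofReal_ne_top⟩ hle

/-- These are the growth conditions of `exists_polynomial_mul_near_one` for `x = ε * 2 ^ j`, with `1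
/ δ` replaced by its upper bound `4 ^ j`. -/
lemma eventually_pow_le_exp {ε : ℝ} (hε : 0 < ε) :
    ∀ᶠ j : ℕ in atTop, (ε * 2 ^ j * 4 ^ j + 1) * Real.exp 1 + 1 ≤ Real.exp (ε * 2 ^ j) ∧
      4 ^ j ≤ Real.exp (ε * 2 ^ j) := by
  have hu : Tendsto (fun j : ℕ => ε * (2 : ℝ) ^ j) atTop atTop :=
    (tendsto_pow_atTop_atTop_of_one_lt one_lt_two).const_mul_atTop hε
  have h3 := (Real.tendsto_pow_mul_exp_neg_atTop_nhds_zero 3).comp hu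
  have h2 := (Real.tendsto_pow_mul_exp_neg_atTop_nhds_zero 2).comp hu
  have h0 := (Real.tendsto_pow_mul_exp_neg_atTop_nhds_zero 0).comp hu
  have hA := ((h3.const_mul (Real.exp 1 / ε ^ 2)).add (h0.const_mul (Real.exp 1 + 1)))
  have hB := h2.const_mul (1 / ε ^ 2)
  simp only [mul_zero, add_zero] at hA hB
  filter_upwards [hA.eventually_le_const one_pos, hB.eventually_le_const one_pos] with j hj1 hj2
  have h4 : (4 : ℝ) ^ j = (2 ^ j) ^ 2 := by
    rw [← pow_mul, mul_comm j 2, pow_mul]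
    norm_num
  have he : Real.exp (-(ε * 2 ^ j)) * Real.exp (ε * 2 ^ j) = 1 := by
    rw [← Real.exp_add]
    simp
  simp only [Function.comp_apply] at hj1 hj2
  have hpos := Real.exp_pos (ε * 2 ^ j)
  have g1 := mul_le_mul_of_nonneg_right hj1 hpos.le
  have g2 := mul_le_mul_of_nonneg_right hj2 hpos.le
  rw [one_mul] at g1 g2
  constructor
  · refine le_of_eq_of_le ?_ g1
    calc _ = (Real.exp 1 / ε ^ 2 * (ε * 2 ^ j) ^ 3 + (Real.exp 1 + 1))
          * (Real.exp (-(ε * 2 ^ j)) * Real.exp (ε * 2 ^ j)) := by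
            rw [he, h4]
            field_simp
            ring
      _ = _ := by ring
  · refine le_of_eq_of_le ?_ g2
    calc _ = 1 / ε ^ 2 * (ε * 2 ^ j) ^ 2
          * (Real.exp (-(ε * 2 ^ j)) * Real.exp (ε * 2 ^ j)) := by
            rw [he, h4]
            field_simp
      _ = _ := by ring

/-- At a scale `δ` with `log (1 / W δ) = 2 ^ j`, a measure with small mass on all arcs of length
comparable to `δ` has a singular inner function with a good polynomial approximate inverse. -/
lemma eventually_exists_polynomial (hW : IsGoodWeight W) :
    ∃ ε > 0, ∀ᶠ j : ℕ in atTop, ∀ (δ c : ℝ) (m : ℕ) (ν : Measure (Metric.sphere (0 : ℂ) 1)),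
      IsFiniteMeasure ν → δ ∈ Ioc (0 : ℝ) 1 → Real.log (1 / W δ) = 2 ^ j → 1 / δ ≤ 4 ^ j →
      2 * Real.pi ≤ δ * 2 ^ m → 4 * 2 ^ m * c ≤ ε * 2 ^ j →
      (∀ i, ν.real {ζ | arcIndex m (angle ζ) = i} ≤ c) →
      ∃ f : ℂ[X], ∀ z : ℂ, ‖z‖ < 1 →
        ‖f.eval z * singularInner ν z‖ ≤ Real.exp (4 * (ε * 2 ^ j)) ∧
        W (1 - ‖z‖) * ‖1 - f.eval z * singularInner ν z‖ ≤ Real.exp (-8 * (ε * 2 ^ j)) := by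
  obtain ⟨C, hC, hdoub⟩ := hW.log_doubling
  obtain ⟨s, hs0, hs⟩ := mem_nhdsGT_iff_exists_Ioo_subset.mp hdoub
  have hs0' : (0 : ℝ) < s := hs0
  have hC0 : 0 < C := by linarith
  -- Four halvings lead from `16 * δ` to `δ`, each costing a factor `C`. The `12 = 4 + 8` lets `W`
  -- absorb the growth `exp (4x)` and still leave `exp (-8x)`.
  set ε : ℝ := 1 / (12 * C ^ 4) with hε
  have hε0 : 0 < ε := by positivity
  refine ⟨ε, hε0, ?_⟩
  have hs1 : 0 < min s 1 / 16 := by positivity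
  filter_upwards [hW.eventually_scale_lt hs1, eventually_pow_le_exp hε0]
    with j hj hjexp δ c m ν hν hδ hlog hδ4 hm hc hcell
  have hδs := hj δ hδ.2 hlog
  have hδ16 : 16 * δ < s := by linarith [min_le_left s 1]
  have hδ1 : 16 * δ < 1 := by linarith [min_le_right s 1]
  have hδ0 : 0 < δ := hδ.1
  set x : ℝ := ε * 2 ^ j with hx
  have hx0 : 0 ≤ x := by positivity
  have hstep : ∀ t, 0 < t → t < s →
      Real.log (1 / W (t / 2)) ≤ C * Real.log (1 / W t) := fun t h1 h2 => hs ⟨h1, h2⟩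
  have hW16 : W (16 * δ) ≤ Real.exp (-12 * x) := by
    rw [hW.eq_exp_neg ⟨by positivity, hδ1.le⟩, Real.exp_le_exp]
    have e1 := hstep (2 * δ) (by positivity) (by linarith)
    have e2 := hstep (4 * δ) (by positivity) (by linarith)
    have e3 := hstep (8 * δ) (by positivity) (by linarith)
    have e4 := hstep (16 * δ) (by positivity) (by linarith)
    rw [show 2 * δ / 2 = δ by ring, hlog] at e1
    rw [show 4 * δ / 2 = 2 * δ by ring] at e2
    rw [show 8 * δ / 2 = 4 * δ by ring] at e3
    rw [show 16 * δ / 2 = 8 * δ by ring] at e4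
    have e5 : (2 : ℝ) ^ j ≤ C ^ 4 * Real.log (1 / W (16 * δ)) := by
      calc (2 : ℝ) ^ j ≤ C * (C * (C * (C * Real.log (1 / W (16 * δ))))) := by
            refine e1.trans ?_
            gcongr
            refine e2.trans ?_
            gcongr
            refine e3.trans ?_
            gcongr
        _ = _ := by ring
    have e6 : 12 * x = 2 ^ j / C ^ 4 := by
      rw [hx, hε]
      field_simp
    rw [neg_mul, neg_le_neg_iff, e6, div_le_iff₀ (by positivity)]
    linarith
  obtain ⟨f, hf1, hf2, hf3⟩ := exists_polynomial_mul_near_one (differentiableOn_singularInner ν)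
    (singularInner_ne_zero ν) (fun z hz => norm_singularInner_le_one ν hz) hδ0 (by linarith) hx0
    (fun z hz => by
      rw [norm_singularInner ν (by linarith), Real.exp_le_exp, neg_le_neg_iff]
      exact (integral_poissonKernel_le hδ0 hm hcell hz).trans hc)
    (by
      refine le_trans ?_ hjexp.1
      rw [div_eq_mul_one_div]
      gcongr)
    (hδ4.trans hjexp.2)
  refine ⟨f, fun z hz => ⟨hf1 z hz, ?_⟩⟩
  have hmem : 1 - ‖z‖ ∈ Ioc (0 : ℝ) 1 := ⟨by linarith, by linarith [norm_nonneg z]⟩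
  rcases le_total ‖z‖ (1 - 16 * δ) with h | h
  · exact (mul_le_of_le_one_left (norm_nonneg _) (hW.mapsTo hmem).2).trans (hf3 z h)
  · calc W (1 - ‖z‖) * ‖1 - f.eval z * singularInner ν z‖
        ≤ Real.exp (-12 * x) * Real.exp (4 * x) := by
          refine mul_le_mul (le_trans ?_ hW16) (hf2 z hz) (norm_nonneg _) (Real.exp_pos _).le
          exact hW.monotoneOn hmem ⟨by positivity, hδ1.le⟩ (by linarith)
      _ = Real.exp (-8 * x) := by
          rw [← Real.exp_add]
          ring_nf

end Weight

end GrowthSpace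

namespace GrowthSpace

open Polynomial

/-! ### Polynomial approximate inverses of singular inner functions -/

lemma one_sub_prod_range (h : ℕ → ℂ) (n : ℕ) :
    1 - ∏ j ∈ Finset.range n, h j
      = ∑ j ∈ Finset.range n, (∏ i ∈ Finset.range j, h i) * (1 - h j) := by
  induction n with
  | zero => simp
  | succ n ih =>
    rw [Finset.sum_range_succ, ← ih, Finset.prod_range_succ]
    ring

/-- Because `2 ^ J + ⋯ + 2 ^ (j - 1 + J) < 2 ^ (j + J)`, the product of the factors before the
`j`-th obeys the same bound as the `j`-th alone. Each telescoped term is thus at most `exp (4x) *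
exp (-8x)`. -/
lemma weighted_one_sub_prod_le {w ε : ℝ} (hw : 0 ≤ w) (hε : 0 ≤ ε) (J : ℕ) {h : ℕ → ℂ} {n : ℕ}
    (h1 : ∀ j < n, ‖h j‖ ≤ Real.exp (4 * (ε * 2 ^ (j + J))))
    (h2 : ∀ j < n, w * ‖1 - h j‖ ≤ Real.exp (-8 * (ε * 2 ^ (j + J)))) :
    w * ‖1 - ∏ j ∈ Finset.range n, h j‖
      ≤ ∑ j ∈ Finset.range n, Real.exp (-4 * (ε * 2 ^ (j + J))) := by
  have hprod : ∀ j ≤ n, ‖∏ i ∈ Finset.range j, h i‖ ≤ Real.exp (4 * (ε * 2 ^ (j + J))) := by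
    intro j
    induction j with
    | zero =>
      intro _
      simp only [Finset.range_zero, Finset.prod_empty, norm_one]
      exact Real.one_le_exp (by positivity)
    | succ j ih =>
      intro hj
      rw [Finset.prod_range_succ, norm_mul]
      calc _ ≤ Real.exp (4 * (ε * 2 ^ (j + J))) * Real.exp (4 * (ε * 2 ^ (j + J))) :=
            mul_le_mul (ih (by omega)) (h1 j (by omega)) (norm_nonneg _) (Real.exp_pos _).le
        _ = _ := by
            rw [← Real.exp_add]
            ring_nf
  rw [one_sub_prod_range]
  calc _ ≤ w * ∑ j ∈ Finset.range n, ‖(∏ i ∈ Finset.range j, h i) * (1 - h j)‖ := by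
        gcongr
        exact norm_sum_le _ _
    _ = ∑ j ∈ Finset.range n, ‖∏ i ∈ Finset.range j, h i‖ * (w * ‖1 - h j‖) := by
        rw [Finset.mul_sum]
        refine Finset.sum_congr rfl fun j _ => ?_
        rw [norm_mul]
        ring
    _ ≤ _ := by
        refine Finset.sum_le_sum fun j hj => ?_
        have hj' := Finset.mem_range.mp hj
        calc _ ≤ Real.exp (4 * (ε * 2 ^ (j + J))) * Real.exp (-8 * (ε * 2 ^ (j + J))) :=
              mul_le_mul (hprod j hj'.le) (h2 j hj') (by positivity) (Real.exp_pos _).le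
          _ = _ := by
              rw [← Real.exp_add]
              ring_nf

lemma singularInner_sum_range {ν : ℕ → Measure (Metric.sphere (0 : ℂ) 1)} {n : ℕ}
    (hν : ∀ j < n, IsFiniteMeasure (ν j)) {z : ℂ} (hz : ‖z‖ < 1) :
    singularInner (∑ j ∈ Finset.range n, ν j) z = ∏ j ∈ Finset.range n, singularInner (ν j) z ∧
      IsFiniteMeasure (∑ j ∈ Finset.range n, ν j) := by
  induction n with
  | zero =>
    simp only [Finset.range_zero, Finset.sum_empty, Finset.prod_empty]
    exact ⟨singularInner_zero z, inferInstance⟩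
  | succ n ih =>
    obtain ⟨h1, h2⟩ := ih fun j hj => hν j (by omega)
    have := hν n (by omega)
    rw [Finset.sum_range_succ, Finset.prod_range_succ, singularInner_add _ _ hz, h1]
    exact ⟨rfl, inferInstance⟩

lemma eventually_tail_exp_le {ε η : ℝ} (hε : 0 < ε) (hη : 0 < η) :
    ∀ᶠ J : ℕ in atTop, ∀ n, ∑ j ∈ Finset.range n, Real.exp (-4 * (ε * 2 ^ (j + J))) ≤ η := by
  have hsum : Summable fun j : ℕ => Real.exp (-4 * (ε * 2 ^ j)) := by
    refine Summable.of_nonneg_of_le (fun _ => (Real.exp_pos _).le) (fun j => ?_)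
      (Real.summable_exp_nat_mul_iff.mpr (show -4 * ε < 0 by linarith))
    rw [Real.exp_le_exp]
    have : (j : ℝ) ≤ 2 ^ j := by exact_mod_cast Nat.lt_two_pow_self.le
    nlinarith
  filter_upwards [(tendsto_sum_nat_add fun j : ℕ => Real.exp (-4 * (ε * 2 ^ j))).eventually_le_const
    hη] with J hJ n
  exact (((summable_nat_add_iff J).mpr hsum).sum_le_tsum _ fun _ _ => (Real.exp_pos _).le).trans hJ

/-- The least `m` for which arcs of length `2π / 2 ^ m` have length at most `δ`. -/
noncomputable def arcLevel (δ : ℝ) : ℕ := Nat.clog 2 ⌈2 * Real.pi / δ⌉₊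

lemma le_mul_two_pow_arcLevel {δ : ℝ} (hδ : 0 < δ) : 2 * Real.pi ≤ δ * 2 ^ arcLevel δ := by
  have h1 : (⌈2 * Real.pi / δ⌉₊ : ℝ) ≤ 2 ^ arcLevel δ := by
    exact_mod_cast Nat.le_pow_clog one_lt_two _
  have h2 := (Nat.le_ceil (2 * Real.pi / δ)).trans h1
  rw [div_le_iff₀ hδ] at h2
  linarith

lemma two_pow_arcLevel_mul_le {δ : ℝ} (hδ : δ ∈ Ioc (0 : ℝ) 1) :
    2 ^ arcLevel δ * δ ≤ 4 * Real.pi := by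
  obtain ⟨h0, h1⟩ := hδ
  have hpi := Real.pi_gt_three
  have hlarge : 1 < 2 * Real.pi / δ := by
    rw [lt_div_iff₀ h0]
    linarith
  have hceil : 1 < ⌈2 * Real.pi / δ⌉₊ := Nat.lt_ceil.mpr (by simpa using hlarge)
  have h2 := Nat.pow_pred_clog_lt_self one_lt_two hceil
  have h3 : (2 : ℝ) ^ (arcLevel δ).pred < 2 * Real.pi / δ := by
    have := Nat.lt_ceil.mp h2
    exact_mod_cast this
  have h4 : 0 < arcLevel δ := Nat.clog_pos one_lt_two hceil
  have h5 : (2 : ℝ) ^ arcLevel δ = 2 * 2 ^ (arcLevel δ).pred := by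
    rw [← pow_succ', ← Nat.succ_eq_add_one, Nat.succ_pred_eq_of_pos h4]
  rw [lt_div_iff₀ h0] at h3
  rw [h5]
  linarith

lemma arcLevel_anti {δ δ' : ℝ} (h0 : 0 < δ) (h : δ ≤ δ') : arcLevel δ' ≤ arcLevel δ := by
  refine Nat.clog_mono_right 2 (Nat.ceil_le_ceil ?_)
  have := Real.pi_pos
  gcongr

/-- For a good weight with divergent logarithmic integral, `1` is the limit of polynomial multiples
of `Θ_μ`. -/
lemma exists_polynomial_mul_singularInner_near_one {W : ℝ → ℝ} (hW : IsGoodWeight W)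
    (hdiv : LogIntegralDiverges W) (μ : Measure (Metric.sphere (0 : ℂ) 1)) [IsFiniteMeasure μ]
    {η : ℝ} (hη : 0 < η) :
    ∃ p : ℂ[X], ∀ z : ℂ, ‖z‖ < 1 → W (1 - ‖z‖) * ‖1 - p.eval z * singularInner μ z‖ ≤ η := by
  have hpi := Real.pi_pos
  obtain ⟨ε, hε, hpoly⟩ := eventually_exists_polynomial hW
  have hscale : ∀ᶠ j : ℕ in atTop, ∃ δ ∈ Ioc (0 : ℝ) 1, Real.log (1 / W δ) = 2 ^ j := by
    filter_upwards [(tendsto_pow_atTop_atTop_of_one_lt (one_lt_two (α := ℝ))).eventually_ge_atTop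
      (Real.log (1 / W 1))] with j hj
    exact hW.exists_scale hj
  obtain ⟨J, hJ⟩ := eventually_atTop.mp
    (hscale.and (hpoly.and (eventually_tail_exp_le hε hη)))
  have hex : ∀ j, ∃ δ : ℝ, J ≤ j → δ ∈ Ioc (0 : ℝ) 1 ∧ Real.log (1 / W δ) = 2 ^ j := by
    intro j
    by_cases hj : J ≤ j
    · obtain ⟨δ, h1, h2⟩ := (hJ j hj).1
      exact ⟨δ, fun _ => ⟨h1, h2⟩⟩
    · exact ⟨0, fun h => absurd h hj⟩
  choose δ hδ using hex
  have hδanti : ∀ i j, J ≤ i → i ≤ j → δ j ≤ δ i := by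
    intro i j hi hij
    rcases hij.eq_or_lt with rfl | hlt
    · exact le_rfl
    · obtain ⟨h1, h2⟩ := hδ i hi
      obtain ⟨h3, h4⟩ := hδ j (hi.trans hij)
      refine (hW.lt_of_log_lt h1.1 h3.2 ?_).le
      rw [h2, h4]
      exact pow_lt_pow_right₀ one_lt_two hlt
  -- The `16π` is the `4` of the Poisson bound times the `4π` of `two_pow_arcLevel_mul_le`. Scales
  -- with `1 / δ j > 4 ^ j` are too fine for the polynomial construction and get cap `0`.
  set c : ℕ → ℝ := fun j => if 1 / δ j ≤ 4 ^ j then ε * 2 ^ j * δ j / (16 * Real.pi) else 0 with hc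
  have hc0 : ∀ j, J ≤ j → 0 ≤ c j := by
    intro j hj
    have := (hδ j hj).1.1
    simp only [hc]
    split_ifs <;> positivity
  -- Discarding the too fine scales is harmless: there `2 ^ j * δ j < 2 ^ (-j)`, which is summable.
  have hnot : ¬ Summable fun j => c (j + J) := by
    intro hs
    refine not_summable_scales hW hdiv (fun j hj => hδ j hj) (k := J) ?_
    have hgeo : Summable fun j : ℕ => ((1 : ℝ) / 2) ^ (j + J) :=
      (summable_nat_add_iff J).mpr (summable_geometric_of_lt_one (by norm_num) (by norm_num))
    refine Summable.of_nonneg_of_le (fun j => ?_) (fun j => ?_)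
      ((hs.mul_left (16 * Real.pi / ε)).add hgeo)
    · have := (hδ (j + J) (by omega)).1.1
      positivity
    · have hpos := (hδ (j + J) (by omega)).1.1
      simp only [hc]
      split_ifs with h
      · have : 16 * Real.pi / ε * (ε * 2 ^ (j + J) * δ (j + J) / (16 * Real.pi))
            = 2 ^ (j + J) * δ (j + J) := by field_simp
        rw [this]
        exact le_add_of_nonneg_right (by positivity)
      · rw [not_le, lt_div_iff₀ hpos] at h
        rw [mul_zero, zero_add, one_div, inv_pow, ← one_div, le_div_iff₀ (by positivity)]
        have h4 : (4 : ℝ) ^ (j + J) = 2 ^ (j + J) * 2 ^ (j + J) := by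
          rw [← mul_pow]
          norm_num
        rw [h4] at h
        linarith
  obtain ⟨n, hn⟩ := (((not_summable_iff_tendsto_nat_atTop_of_nonneg
    fun j => hc0 (j + J) (by omega)).mp hnot).eventually_ge_atTop (μ.real univ)).exists
  have hmass : μ univ ≤ ∑ j ∈ Finset.range n, ENNReal.ofReal (c (j + J)) := by
    rw [← ENNReal.ofReal_sum_of_nonneg fun j _ => hc0 (j + J) (by omega),
      ← ofReal_measureReal (measure_ne_top μ univ)]
    exact ENNReal.ofReal_le_ofReal hn
  obtain ⟨ν, hμν, hν⟩ := exists_decomposition μ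
    (p := fun j ζ => arcIndex (arcLevel (δ (j + J))) (angle ζ))
    (fun j => (measurable_arcIndex _).comp measurable_angle)
    (fun j k hjk x y h => arcIndex_congr (arcLevel_anti (hδ (k + J) (by omega)).1.1
      (hδanti (j + J) (k + J) (by omega) (by omega))) h) hmass
  have hfin : ∀ j < n, IsFiniteMeasure (ν j) := by
    intro j hj
    refine isFiniteMeasure_of_le μ ?_
    rw [hμν]
    exact Finset.single_le_sum (f := ν) (fun _ _ => Measure.zero_le _) (Finset.mem_range.mpr hj)
  have hf : ∀ j, ∃ f : ℂ[X], j < n → ∀ z : ℂ, ‖z‖ < 1 →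
      ‖f.eval z * singularInner (ν j) z‖ ≤ Real.exp (4 * (ε * 2 ^ (j + J))) ∧
      W (1 - ‖z‖) * ‖1 - f.eval z * singularInner (ν j) z‖
        ≤ Real.exp (-8 * (ε * 2 ^ (j + J))) := by
    intro j
    by_cases hj : j < n
    swap
    · exact ⟨0, fun h => absurd h hj⟩
    have := hfin j hj
    obtain ⟨h1, h2⟩ := hδ (j + J) (by omega)
    by_cases hgood : 1 / δ (j + J) ≤ 4 ^ (j + J)
    · obtain ⟨f, hf⟩ := (hJ (j + J) (by omega)).2.1 (δ (j + J)) (c (j + J))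
        (arcLevel (δ (j + J))) (ν j) this h1 h2 hgood (le_mul_two_pow_arcLevel h1.1)
        (by
          simp only [hc, if_pos hgood]
          rw [mul_div_assoc', div_le_iff₀ (by positivity)]
          have := mul_le_mul_of_nonneg_left (two_pow_arcLevel_mul_le h1)
            (show 0 ≤ 4 * (ε * 2 ^ (j + J)) by positivity)
          linarith)
        (fun i => ENNReal.toReal_le_of_le_ofReal (hc0 (j + J) (by omega)) (hν j hj i))
      exact ⟨f, fun _ => hf⟩
    · have hzero : ν j = 0 := by
        have hcj : c (j + J) = 0 := if_neg hgood
        rw [← Measure.measure_univ_eq_zero, show (univ : Set (Metric.sphere (0 : ℂ) 1))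
          = ⋃ i, (fun ζ => arcIndex (arcLevel (δ (j + J))) (angle ζ)) ⁻¹' {i} by ext; simp,
          measure_iUnion_null_iff]
        intro i
        simpa [hcj] using hν j hj i
      refine ⟨1, fun _ z _ => ?_⟩
      rw [hzero, singularInner_zero]
      simp only [eval_one, mul_one, norm_one, sub_self, norm_zero, mul_zero]
      exact ⟨Real.one_le_exp (by positivity), (Real.exp_pos _).le⟩
  choose f hf using hf
  refine ⟨∏ j ∈ Finset.range n, f j, fun z hz => ?_⟩
  have hprod : (∏ j ∈ Finset.range n, f j).eval z * singularInner μ z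
      = ∏ j ∈ Finset.range n, (f j).eval z * singularInner (ν j) z := by
    conv_lhs => rw [hμν, (singularInner_sum_range hfin hz).1]
    rw [eval_prod, Finset.prod_mul_distrib]
  have hw : 0 ≤ W (1 - ‖z‖) :=
    (hW.mapsTo ⟨by linarith, by linarith [norm_nonneg z]⟩).1.le
  rw [hprod]
  exact (weighted_one_sub_prod_le hw hε.le J (fun j hj => (hf j hj z hz).1)
    fun j hj => (hf j hj z hz).2).trans ((hJ J le_rfl).2.2 n)

end GrowthSpace

namespace GrowthSpace

open Polynomial

/-! ### Density of polynomials and cyclicity -/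

/-- The Taylor series of `g` converges absolutely at `r < 1`, so that of the dilate converges
uniformly on the unit disc. -/
lemma exists_polynomial_near_dilation {g : ℂ → ℂ} (hg : DifferentiableOn ℂ g (Metric.ball 0 1))
    {r η : ℝ} (hr0 : 0 ≤ r) (hr1 : r < 1) (hη : 0 < η) :
    ∃ q : ℂ[X], ∀ z : ℂ, ‖z‖ < 1 → ‖g (r * z) - q.eval z‖ ≤ η := by
  obtain ⟨c, hsum, -⟩ := exists_taylor_coeff hg
  have hs : Summable fun n => ‖c n * (r : ℂ) ^ n‖ :=
    (hsum r (by simpa [abs_of_nonneg hr0] using hr1)).summable.norm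
  obtain ⟨N, hN⟩ := ((tendsto_sum_nat_add fun n => ‖c n * (r : ℂ) ^ n‖).eventually_le_const
    hη).exists
  refine ⟨∑ n ∈ Finset.range N, C (c n * (r : ℂ) ^ n) * X ^ n, fun z hz => ?_⟩
  have heval : (∑ n ∈ Finset.range N, C (c n * (r : ℂ) ^ n) * X ^ n).eval z
      = ∑ n ∈ Finset.range N, c n * (r * z) ^ n := by
    rw [eval_finsetSum]
    refine Finset.sum_congr rfl fun n _ => ?_
    simp only [eval_mul, eval_C, eval_pow, eval_X]
    ring
  have hrz : ‖(r : ℂ) * z‖ < 1 := by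
    rw [norm_mul, Complex.norm_real, Real.norm_of_nonneg hr0]
    nlinarith [norm_nonneg z]
  have htail := (hasSum_nat_add_iff' N).mpr (hsum _ hrz)
  rw [← heval] at htail
  rw [← htail.tsum_eq]
  refine (tsum_of_norm_bounded ((summable_nat_add_iff N).mpr hs).hasSum fun n => ?_).trans hN
  rw [mul_pow, ← mul_assoc, norm_mul _ (z ^ _), norm_pow z]
  exact mul_le_of_le_one_right (norm_nonneg _) (pow_le_one₀ (norm_nonneg _) hz.le)

/-- Polynomials are dense in `A^∞(W)`. -/
lemma exists_polynomial_near {W : ℝ → ℝ} (hW : IsGoodWeight W) {g : ℂ → ℂ} (hg : MemAInfty W g)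
    {η : ℝ} (hη : 0 < η) :
    ∃ q : ℂ[X], ∀ z : ℂ, ‖z‖ < 1 → W (1 - ‖z‖) * ‖g z - q.eval z‖ ≤ η := by
  have hη3 : 0 < η / 3 := by positivity
  obtain ⟨a, ha1, ha⟩ : ∃ a < 1, ∀ z : ℂ, a < ‖z‖ → ‖z‖ < 1 → W (1 - ‖z‖) * ‖g z‖ ≤ η / 3 := by
    have h := eventually_comap.mp (hg.tendsto_zero.eventually_le_const hη3)
    obtain ⟨a, ha1, ha⟩ := mem_nhdsLT_iff_exists_Ioo_subset.mp h
    exact ⟨a, ha1, fun z h1 h2 => ha ⟨h1, h2⟩ z rfl⟩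
  set b : ℝ := (1 + a) / 2 with hb
  have hab : a < b := by rw [hb]; linarith
  have hb1 : b < 1 := by rw [hb]; linarith
  have huc : UniformContinuousOn g (Metric.closedBall 0 b) :=
    (isCompact_closedBall 0 b).uniformContinuousOn_of_continuous
      (hg.holomorphic.continuousOn.mono (Metric.closedBall_subset_ball hb1))
  obtain ⟨d, hd, hgd⟩ := Metric.uniformContinuousOn_iff.mp huc (η / 3) hη3
  -- `1 - d < r` makes the dilation move points by less than `d`, for uniform continuity on `‖z‖ ≤
  -- b`. `a < r * b` keeps the dilate of a point with `‖z‖ > b` in the zone where `W |g|` is small.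
  obtain ⟨r, ⟨hrd, hrb⟩, hr0, hr1⟩ : ∃ r : ℝ, (1 - d < r ∧ a < r * b) ∧ 0 < r ∧ r < 1 := by
    have h1 : ∀ᶠ r : ℝ in 𝓝[<] 1, 1 - d < r :=
      nhdsWithin_le_nhds (lt_mem_nhds (by linarith))
    have h2 : ∀ᶠ r : ℝ in 𝓝[<] 1, a < r * b := by
      refine nhdsWithin_le_nhds ?_
      have : Tendsto (fun r : ℝ => r * b) (𝓝 1) (𝓝 (1 * b)) := tendsto_id.mul_const b
      exact this.eventually_const_lt (by linarith)
    have h3 : ∀ᶠ r : ℝ in 𝓝[<] 1, 0 < r ∧ r < 1 := Ioo_mem_nhdsLT zero_lt_one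
    exact ((h1.and h2).and h3).exists
  obtain ⟨q, hq⟩ := exists_polynomial_near_dilation hg.holomorphic hr0.le hr1 hη3
  refine ⟨q, fun z hz => ?_⟩
  have hz0 := norm_nonneg z
  have hmem : 1 - ‖z‖ ∈ Ioc (0 : ℝ) 1 := ⟨by linarith, by linarith⟩
  obtain ⟨hw0, hw1⟩ := hW.mapsTo hmem
  have hrz : ‖(r : ℂ) * z‖ = r * ‖z‖ := by
    rw [norm_mul, Complex.norm_real, Real.norm_of_nonneg hr0.le]
  have hrz1 : r * ‖z‖ ≤ ‖z‖ := mul_le_of_le_one_left hz0 hr1.le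
  have hpoly : W (1 - ‖z‖) * ‖g (r * z) - q.eval z‖ ≤ η / 3 :=
    (mul_le_of_le_one_left (norm_nonneg _) hw1).trans (hq z hz)
  have hdil : W (1 - ‖z‖) * ‖g z - g (r * z)‖ ≤ 2 * (η / 3) := by
    rcases le_or_gt ‖z‖ b with h | h
    · have hdist := hgd z (by simpa using h) (r * z) (by
        rw [mem_closedBall_zero_iff, hrz]
        exact hrz1.trans h) (by
        rw [dist_eq_norm, show z - r * z = ((1 - r : ℝ) : ℂ) * z by push_cast; ring, norm_mul,
          Complex.norm_real, Real.norm_of_nonneg (by linarith)]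
        nlinarith)
      rw [dist_eq_norm] at hdist
      exact (mul_le_of_le_one_left (norm_nonneg _) hw1).trans (by linarith)
    · have e1 := ha z (by linarith) hz
      have e2 := ha (r * z) (by rw [hrz]; nlinarith) (by rw [hrz]; linarith)
      rw [hrz] at e2
      have e3 : W (1 - ‖z‖) ≤ W (1 - r * ‖z‖) := by
        refine hW.monotoneOn hmem ⟨by linarith, ?_⟩ (by linarith)
        have : 0 ≤ r * ‖z‖ := by positivity
        linarith
      calc W (1 - ‖z‖) * ‖g z - g (r * z)‖ ≤ W (1 - ‖z‖) * (‖g z‖ + ‖g (r * z)‖) := by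
            gcongr
            exact norm_sub_le _ _
        _ = W (1 - ‖z‖) * ‖g z‖ + W (1 - ‖z‖) * ‖g (r * z)‖ := by ring
        _ ≤ η / 3 + W (1 - r * ‖z‖) * ‖g (r * z)‖ := by gcongr
        _ ≤ _ := by linarith
  calc W (1 - ‖z‖) * ‖g z - q.eval z‖
      ≤ W (1 - ‖z‖) * (‖g z - g (r * z)‖ + ‖g (r * z) - q.eval z‖) := by
        gcongr
        exact norm_sub_le_norm_sub_add_norm_sub _ _ _
    _ ≤ η := by linarith

lemma polynomial_mul_mem_span (p : ℂ[X]) (f : ℂ → ℂ) :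
    (fun z => p.eval z * f z) ∈ Submodule.span ℂ (range fun (n : ℕ) (z : ℂ) => z ^ n * f z) := by
  have h : (fun z => p.eval z * f z)
      = ∑ n ∈ Finset.range (p.natDegree + 1), p.coeff n • fun z : ℂ => z ^ n * f z := by
    ext z
    rw [eval_eq_sum_range, Finset.sum_mul, Finset.sum_apply]
    exact Finset.sum_congr rfl fun n _ => by simp [mul_assoc]
  rw [h]
  exact Submodule.sum_mem _ fun n _ => Submodule.smul_mem _ _ (Submodule.subset_span ⟨n, rfl⟩)

lemma exists_norm_eval_le (q : ℂ[X]) : ∃ K > 0, ∀ z : ℂ, ‖z‖ < 1 → ‖q.eval z‖ ≤ K := by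
  obtain ⟨K, hK⟩ := (isCompact_closedBall (0 : ℂ) 1).exists_bound_of_continuousOn
    (f := fun z => q.eval z) q.continuous.continuousOn
  exact ⟨max K 1, by positivity, fun z hz => (hK z (by simpa using hz.le)).trans (le_max_left _ _)⟩

lemma memAInfty_singularInner {W : ℝ → ℝ} (hW : IsGoodWeight W)
    (μ : Measure (Metric.sphere (0 : ℂ) 1)) [IsFiniteMeasure μ] :
    MemAInfty W (singularInner μ) := by
  refine ⟨differentiableOn_singularInner μ, ?_⟩
  have hlim : Tendsto (fun t : ℝ => W (1 - t)) (𝓝[<] 1) (𝓝 0) := by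
    refine hW.tendsto_zero.comp (tendsto_nhdsWithin_iff.mpr ⟨?_, ?_⟩)
    · have : Tendsto (fun t : ℝ => 1 - t) (𝓝 1) (𝓝 (1 - 1)) := tendsto_id.const_sub 1
      rw [sub_self] at this
      exact this.mono_left nhdsWithin_le_nhds
    · filter_upwards [self_mem_nhdsWithin] with t ht
      exact sub_pos.mpr (mem_Iio.mp ht)
  have hmem : ∀ᶠ z : ℂ in comap (fun z : ℂ => ‖z‖) (𝓝[<] 1), ‖z‖ < 1 :=
    tendsto_comap.eventually self_mem_nhdsWithin
  refine squeeze_zero' ?_ ?_ (hlim.comp tendsto_comap) <;> filter_upwards [hmem] with z hz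
  all_goals
    have hw := (hW.mapsTo (x := 1 - ‖z‖) ⟨by linarith, by linarith [norm_nonneg z]⟩).1
  · positivity
  · exact mul_le_of_le_one_right hw.le (norm_singularInner_le_one μ hz)

end GrowthSpace

theorem theorem4p1 (W : ℝ → ℝ) (hW : GrowthSpace.IsGoodWeight W)
    (hdiv : GrowthSpace.LogIntegralDiverges W)
    (μ : MeasureTheory.Measure (Metric.sphere (0 : ℂ) 1)) [MeasureTheory.IsFiniteMeasure μ]
    (hμ : μ.MutuallySingular GrowthSpace.arcLength) :
    GrowthSpace.IsCyclicAInfty W (GrowthSpace.singularInner μ) := by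
  refine ⟨GrowthSpace.memAInfty_singularInner hW μ, fun g hg ε hε => ?_⟩
  obtain ⟨η, hη0, hηε⟩ := ENNReal.lt_iff_exists_real_btwn.mp hε
  have hη : 0 < η := ENNReal.ofReal_pos.mp hηε.1
  obtain ⟨q, hq⟩ := GrowthSpace.exists_polynomial_near hW hg (half_pos hη)
  obtain ⟨K, hK, hqK⟩ := GrowthSpace.exists_norm_eval_le q
  obtain ⟨p, hp⟩ := GrowthSpace.exists_polynomial_mul_singularInner_near_one hW hdiv μ
    (div_pos (half_pos hη) hK)
  -- With `q` near `g` and `p Θ_μ` near `1`, the approximant is `q p Θ_μ`. The bound `K` for `q` on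
  -- the disc explains the tolerance `η / 2 / K` for `p`.
  refine ⟨_, GrowthSpace.polynomial_mul_mem_span (q * p) (GrowthSpace.singularInner μ),
    lt_of_le_of_lt (iSup₂_le fun z hz => ENNReal.ofReal_le_ofReal ?_) hηε.2⟩
  have hz1 : ‖z‖ < 1 := by simpa using hz
  have hw := (hW.mapsTo (x := 1 - ‖z‖) ⟨by linarith, by linarith [norm_nonneg z]⟩).1
  set s := GrowthSpace.singularInner μ z with hs
  have hsplit : (g - fun z => (q * p).eval z * GrowthSpace.singularInner μ z) z
      = (g z - q.eval z) + q.eval z * (1 - p.eval z * s) := by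
    simp only [Pi.sub_apply, Polynomial.eval_mul, hs]
    ring
  rw [hsplit]
  calc W (1 - ‖z‖) * ‖(g z - q.eval z) + q.eval z * (1 - p.eval z * s)‖
      ≤ W (1 - ‖z‖) * (‖g z - q.eval z‖ + ‖q.eval z‖ * ‖1 - p.eval z * s‖) := by
        gcongr
        exact (norm_add_le _ _).trans_eq (by rw [norm_mul])
    _ = W (1 - ‖z‖) * ‖g z - q.eval z‖
        + ‖q.eval z‖ * (W (1 - ‖z‖) * ‖1 - p.eval z * s‖) := by ring
    _ ≤ η / 2 + K * (η / 2 / K) := by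
        have := hqK z hz1
        have := hp z hz1
        have := hq z hz1
        gcongr
    _ = η := by
        field_simp
        ring
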